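/- Let $V$ be a complex vector space of dimension $n\ge 1$ and let $G\subset GL(V)$ be a finite complex reflection group, acting on $\mathbb C[V]=\mathrm{Sym}(V^*)$ by $(g\cdot F)(v)=F(g^{-1}v)$. A set of basic invariants is a tuple $x=(x^1,\dots,x^n)$ of algebraically independent homogeneous generators of $\mathbb C[V]^G$ of degrees $d_1\le\dots\le d_n$; these degrees are determined by $G$. For $a,b\in\mathbb Z_{\ge 0}^n$ put $d\cdot a=\sum_\alpha d_\alpha a_\alpha$, $|a|=\sum_\alpha a_\alpha$, $b!=\prod_\alpha b_\alpha!$, and $[x-x(q)]^a=\prod_\alpha (x^\alpha-x^\alpha(q))^{a_\alpha}$. Let $(g,\zeta,q)$ be an admissible triplet: $g\in G$; $\zeta$ is a primitive $d_n$-th root of unity; $0\neq q\in V$ and $gq=\zeta q$; the Jacobian matrix at $q$ of a set of basic invariants with respect to linear coordinates of $V$ is invertible; and the eigenvalues of $g$ on $V$, with multiplicity, are $\zeta^{1-d_\alpha}$ ($1\le\alpha\le n$). Let $z^1,\dots,z^n$ be a basis of $V^*$ with $g\cdot z^\alpha=\zeta^{d_\alpha-1}z^\alpha$ for all $\alpha$,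 and write $\partial^b=\partial^b/\partial z^b$. Fix a set of basic invariants $y^1,\dots,y^n$ and let $\psi:\mathbb C[V]^G\to\mathbb C[V]$ be the $\mathbb C$-linear map with $$\psi(y^a)=\sum_{d\cdot b=d\cdot a}\frac1{b!}\,\partial^b[y-y(q)]^a(q)\,z^b\qquad(a\in\mathbb Z_{\ge0}^n).$$ A set of basic invariants $x$ is called good if $x^1,\dots,x^n$ form a $\mathbb C$-basis of $\psi^{-1}(V^*)$, and compatible with $z$ if the matrix $\bigl(\frac{\partial x^\alpha}{\partial z^\beta}(q)\bigr)_{\alpha,\beta}$ is the unit matrix. Then, whatever the choice of $y$: (i) $\psi$ is bijective, and $x^\alpha:=\psi^{-1}(z^\alpha)$ ($1\le\alpha\le n$) is a set of basic invariants which is good and compatible with $z$. (ii) Conversely, if a set of basic invariants $x$ is good and compatible with $z$, then $\psi(x^\alpha)=z^\alpha$ for $1\le\alpha\le n$. (iii) For any set of basic invariants $x$ and all $a,b\in\mathbb Z_{\ge0}^n$, $\partial^b[x-x(q)]^a(q)=0$ if $d\cdot b\notin\{d\cdot a+d_nj\mid j\in\mathbb Z_{\ge0}\}$. (iv) A set of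 basic invariants $x$ is good if and only if $\partial^a x^\alpha(q)=0$ for all $1\le\alpha\le n$ and all $a\in\mathbb Z_{\ge0}^n$ with $d\cdot a=d_\alpha$ and $|a|\ge2$. (v) If a set of basic invariants $x$ is good and compatible with $z$, then $\frac1{b!}\,\partial^b[x-x(q)]^a(q)=\delta_{a,b}$ for all $a,b\in\mathbb Z_{\ge0}^n$ with $d\cdot a=d\cdot b$. -/

import Mathlib

namespace GoodInvariants

open Module

noncomputable section

variable {V : Type*} [AddCommGroup V] [Module ℂ V] {n : ℕ}

/-- `ℂ[V]`: the symmetric algebra of the dual space `V*`. -/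
abbrev PolyAlg (V : Type*) [AddCommGroup V] [Module ℂ V] : Type _ :=
  SymmetricAlgebra ℂ (Dual ℂ V)

/-- The natural inclusion `V* ⊂ ℂ[V]`. -/
abbrev lin : Dual ℂ V →ₗ[ℂ] PolyAlg V := SymmetricAlgebra.ι ℂ (Dual ℂ V)

/-- The subspace `V*` of `ℂ[V]`. -/
def dualPart (V : Type*) [AddCommGroup V] [Module ℂ V] : Submodule ℂ (PolyAlg V) :=
  LinearMap.range (lin (V := V))

/-- The value `F(v)` of the polynomial function `F` at `v`. -/
def evalAt (v : V) : PolyAlg V →ₐ[ℂ] ℂ :=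
  SymmetricAlgebra.lift (Dual.eval ℂ V v)

/-- The action of `g ∈ GL(V)` on `ℂ[V]`: the algebra map sending the linear form `l` to
`l ∘ g⁻¹`. -/
def act (g : V ≃ₗ[ℂ] V) : PolyAlg V →ₐ[ℂ] PolyAlg V :=
  SymmetricAlgebra.lift (lin ∘ₗ g.symm.toLinearMap.dualMap)

/-- `(g · F)(v) = F(g⁻¹ v)`. -/
theorem evalAt_act (g : V ≃ₗ[ℂ] V) (v : V) (F : PolyAlg V) :
    evalAt v (act g F) = evalAt (g.symm v) F := by
  have h : (evalAt v).comp (act g) = evalAt (g.symm v) := by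
    apply SymmetricAlgebra.algHom_ext
    ext l
    simp [evalAt, act]
  exact DFunLike.congr_fun h F

/-- `ℂ[V]^G`. -/
def invariants (G : Subgroup (V ≃ₗ[ℂ] V)) : Subalgebra ℂ (PolyAlg V) where
  carrier := {F | ∀ g ∈ G, act g F = F}
  mul_mem' ha hb g hg := by rw [map_mul, ha g hg, hb g hg]
  add_mem' ha hb g hg := by rw [map_add, ha g hg, hb g hg]
  algebraMap_mem' c g _ := AlgHom.commutes (act g) c

/-- `r` is a reflection: it is diagonalizable and all but one of its eigenvalues are `1`. -/
def IsReflection (r : V ≃ₗ[ℂ] V) : Prop :=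
  ∃ (e : Basis (Fin (finrank ℂ V)) ℂ V) (μ : Fin (finrank ℂ V) → ℂ) (i₀ : Fin (finrank ℂ V)),
    (∀ i, r (e i) = μ i • e i) ∧ μ i₀ ≠ 1 ∧ ∀ i, i ≠ i₀ → μ i = 1

/-- `G` is generated by the reflections it contains. -/
def IsReflectionGroup (G : Subgroup (V ≃ₗ[ℂ] V)) : Prop :=
  Subgroup.closure {r | r ∈ G ∧ IsReflection r} = G

/-- `x` is a set of basic invariants of `G`, of degrees `d 1 ≤ ⋯ ≤ d n`: algebraically independent
homogeneous generators of `ℂ[V]^G`, where the part of degree `j` of `ℂ[V]` is `(V*)^j`, the span of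
all products of `j` linear forms. -/
structure IsBasicInvariants (G : Subgroup (V ≃ₗ[ℂ] V)) (d : Fin n → ℕ)
    (x : Fin n → invariants G) : Prop where
  monotone : Monotone d
  homogeneous : ∀ α, (x α : PolyAlg V) ∈ dualPart V ^ d α
  algebraicIndependent : AlgebraicIndependent ℂ x
  adjoin_eq_top : Algebra.adjoin ℂ (Set.range x) = ⊤

/-- The partial derivative `∂/∂z^i` on `ℂ[V]` with respect to the coordinates `z`. -/
def partialDeriv (z : Basis (Fin n) ℂ (Dual ℂ V)) (i : Fin n) : Module.End ℂ (PolyAlg V) :=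
  (SymmetricAlgebra.equivMvPolynomial z).symm.toLinearMap ∘ₗ
    (MvPolynomial.pderiv i).toLinearMap ∘ₗ (SymmetricAlgebra.equivMvPolynomial z).toLinearMap

/-- `∂^b/∂z^b = (∂/∂z^1)^(b 1) ∘ ⋯ ∘ (∂/∂z^n)^(b n)`. -/
def iterDeriv (z : Basis (Fin n) ℂ (Dual ℂ V)) (b : Fin n →₀ ℕ) : Module.End ℂ (PolyAlg V) :=
  (List.ofFn fun i => partialDeriv z i ^ b i).prod

/-- `z^b`, as an element of `ℂ[V]`. -/
def monomial (z : Basis (Fin n) ℂ (Dual ℂ V)) (b : Fin n →₀ ℕ) : PolyAlg V :=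
  ∏ i, lin (z i) ^ b i

/-- `d · b = d 1 * b 1 + ⋯ + d n * b n`. -/
def wdeg (d : Fin n → ℕ) (b : Fin n →₀ ℕ) : ℕ := ∑ i, d i * b i

/-- `|a| = a 1 + ⋯ + a n`. -/
def size (a : Fin n →₀ ℕ) : ℕ := ∑ i, a i

/-- `b! = (b 1)! ⋯ (b n)!`. -/
def multiFactorial (b : Fin n →₀ ℕ) : ℕ := ∏ i, (b i).factorial

/-- `[x - x(q)]^a`. -/
def shiftedMonomial {G : Subgroup (V ≃ₗ[ℂ] V)} (x : Fin n → invariants G) (q : V)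
    (a : Fin n →₀ ℕ) : PolyAlg V :=
  ∏ i, ((x i : PolyAlg V) - algebraMap ℂ (PolyAlg V) (evalAt q (x i))) ^ a i

/-- The Jacobian matrix `(∂x^α/∂z^β (q))`. -/
def jacobian {G : Subgroup (V ≃ₗ[ℂ] V)} (x : Fin n → invariants G)
    (z : Basis (Fin n) ℂ (Dual ℂ V)) (q : V) : Matrix (Fin n) (Fin n) ℂ :=
  Matrix.of fun α β => evalAt q (partialDeriv z β (x α))

/-- The triplet `(g, ζ, q)` is admissible for `G`, a group with degrees `d 1 ≤ ⋯ ≤ d n`. The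
Jacobian matrix is taken for a set of basic invariants and linear coordinates; its
invertibility does not depend on them. -/
structure IsAdmissible [FiniteDimensional ℂ V] [NeZero n] (G : Subgroup (V ≃ₗ[ℂ] V))
    (d : Fin n → ℕ) (g : V ≃ₗ[ℂ] V) (ζ : ℂ) (q : V) : Prop where
  mem : g ∈ G
  ne_zero : q ≠ 0
  eigenvector : g q = ζ • q
  primitive : IsPrimitiveRoot ζ (d ⊤)
  regular : ∃ (x : Fin n → invariants G) (z : Basis (Fin n) ℂ (Dual ℂ V)),
    IsBasicInvariants G d x ∧ IsUnit (jacobian x z q)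
  /-- With multiplicities, the eigenvalues of `g` on `V` are `ζ^(1 - d α)`. -/
  eigenvalues : (g.toLinearMap.charpoly).roots =
    (Finset.univ : Finset (Fin n)).val.map fun α => ζ ^ (1 - (d α : ℤ))

section psi

variable {G : Subgroup (V ≃ₗ[ℂ] V)} {d : Fin n → ℕ} {x : Fin n → invariants G}

/-- The basis `x^a` of `ℂ[V]^G` given by the monomials in basic invariants `x`. -/
def monomialBasis (hx : IsBasicInvariants G d x) :
    Basis (Fin n →₀ ℕ) ℂ (invariants G) :=
  (MvPolynomial.basisMonomials (Fin n) ℂ).map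
    ((hx.algebraicIndependent.aevalEquiv.trans
      (Subalgebra.equivOfEq _ _ hx.adjoin_eq_top)).trans Subalgebra.topEquiv).toLinearEquiv

theorem monomialBasis_apply (hx : IsBasicInvariants G d x) (a : Fin n →₀ ℕ) :
    monomialBasis hx a = ∏ i, x i ^ a i := by
  have h : monomialBasis hx a = MvPolynomial.aeval x (MvPolynomial.monomial a (1 : ℂ)) := by
    rw [← hx.algebraicIndependent.algebraMap_aevalEquiv]
    simp only [monomialBasis, Basis.map_apply, MvPolynomial.coe_basisMonomials]
    rfl
  rw [h, MvPolynomial.aeval_monomial, map_one, one_mul,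
    Finsupp.prod_fintype _ _ (fun i => pow_zero _)]

/-- The linear map `ψ[g, ζ, q] : ℂ[V]^G → ℂ[V]`,
`x^a ↦ ∑_{d·b = d·a} (1/b!) (∂^b [x - x(q)]^a / ∂z^b)(q) z^b`. The sum has finitely many nonzero
terms, since a polynomial has finitely many nonzero partial derivatives. The map depends on `g` and
`ζ` only through the coordinates `z`, which are eigenvectors of `g`. -/
def psi (hx : IsBasicInvariants G d x) (z : Basis (Fin n) ℂ (Dual ℂ V)) (q : V) :
    invariants G →ₗ[ℂ] PolyAlg V :=
  (monomialBasis hx).constr ℂ fun a =>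
    ∑ᶠ (b : Fin n →₀ ℕ) (_ : wdeg d b = wdeg d a),
      ((1 / (multiFactorial b : ℂ)) * evalAt q (iterDeriv z b (shiftedMonomial x q a))) •
        monomial z b

end psi

/-- The elements `x` form a basis of the vector space `Ψ⁻¹(V*)`; for `Ψ = ψ[g, ζ, q]` this is the
goodness of the basic invariants `x`. -/
def IsGood {G : Subgroup (V ≃ₗ[ℂ] V)} (Ψ : invariants G →ₗ[ℂ] PolyAlg V)
    (x : Fin n → invariants G) : Prop :=
  LinearIndependent ℂ x ∧ Submodule.span ℂ (Set.range x) = (dualPart V).comap Ψ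

/-- `x` is compatible with `z`: the Jacobian matrix at `q` is the unit matrix. -/
def IsCompatible {G : Subgroup (V ≃ₗ[ℂ] V)} (x : Fin n → invariants G)
    (z : Basis (Fin n) ℂ (Dual ℂ V)) (q : V) : Prop :=
  jacobian x z q = 1

end

end GoodInvariants

open GoodInvariants

/-! Give z^α the weight d_α, put N = d_n, and expand invariants at q in the coordinates z. The
element g multiplies z^m by ζ^(d·m - |m|), so an invariant homogeneous of degree k contains only
monomials with d·m ≡ k mod N. Moreover gq = ζq forces z^α(q) = 0 unless N divides d_α, so moving the
origin to q preserves these residues. As 0 < d_α ≤ N, the nonconstant Taylor terms of x^α have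
weights d_α, d_α + N, ... (`IsBasicInvariants.hasProgressionWeights`); taking products gives (iii).

Call the component of weight d_α the leading part of x^α. Weights being bounded below, the lowest
component of [x - x(q)]^a is the product of the leading parts, so ψ is the algebra map sending y^α
to its leading part (`psi_aeval`). The linear terms of the leading parts form the Jacobian matrix at
q. It is invertible, and a weighted homogeneous substitution with invertible linear part is
bijective (`bijective_aeval_of_isUnit_linearPart`); hence ψ is.

Finally ψ sends every basic invariant, not only y^α, to its leading part (`psi_basicInvariant`). So
x is good exactly when its leading parts are linear forms, which is (iv), and good and compatible
exactly when they are the coordinates; this yields the rest of (i), (ii) and (v). -/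

namespace GoodInvariants

open Module MvPolynomial

/-! ### Weights of monomials and lowest components of products -/

section Weights

variable {σ τ R : Type*} [CommRing R]

/-- Polynomials all of whose monomials have `v`-weight in `A`. -/
def weightsIn (R : Type*) [CommRing R] (v : τ → ℕ) (A : Set ℕ) :
    Submodule R (MvPolynomial τ R) where
  carrier := {p | ∀ m, coeff m p ≠ 0 → Finsupp.weight v m ∈ A}
  zero_mem' m h := absurd (coeff_zero m) h
  add_mem' {p p'} hp hp' m h := by
    by_cases h1 : coeff m p = 0
    · refine hp' m fun h2 => h ?_
      rw [coeff_add, h1, h2, add_zero]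
    · exact hp m h1
  smul_mem' c p hp m h := hp m fun h1 => h (by rw [coeff_smul, h1, smul_zero])

theorem weightsIn_mono {v : τ → ℕ} {A B : Set ℕ} (h : A ⊆ B) :
    weightsIn R v A ≤ weightsIn R v B := fun _ hp m hm => h (hp m hm)

theorem C_mem_weightsIn (v : τ → ℕ) {A : Set ℕ} (h : 0 ∈ A) (c : R) :
    C c ∈ weightsIn R v A := by
  classical
  intro m hm
  rw [coeff_C] at hm
  have : m = 0 := by
    by_contra h'
    exact hm (if_neg (Ne.symm h'))
  rw [this, map_zero]
  exact h

theorem X_mem_weightsIn {v : τ → ℕ} {A : Set ℕ} {i : τ} (h : v i ∈ A) :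
    (X i : MvPolynomial τ R) ∈ weightsIn R v A := by
  classical
  intro m hm
  rw [coeff_X] at hm
  have : Finsupp.single i 1 = m := by
    by_contra h'
    exact hm (if_neg h')
  rw [← this, Finsupp.weight_single, one_smul]
  exact h

theorem mul_mem_weightsIn {v : τ → ℕ} {A B D : Set ℕ} (h : ∀ i ∈ A, ∀ j ∈ B, i + j ∈ D)
    {p p' : MvPolynomial τ R} (hp : p ∈ weightsIn R v A) (hp' : p' ∈ weightsIn R v B) :
    p * p' ∈ weightsIn R v D := by
  classical
  intro m hm
  rw [coeff_mul] at hm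
  obtain ⟨⟨i, j⟩, hij, hne⟩ := Finset.exists_ne_zero_of_sum_ne_zero hm
  rw [Finset.HasAntidiagonal.mem_antidiagonal] at hij
  rw [← hij, map_add]
  exact h _ (hp _ (left_ne_zero_of_mul hne)) _ (hp' _ (right_ne_zero_of_mul hne))

theorem mem_weightsIn_singleton {v : τ → ℕ} {k : ℕ} {p : MvPolynomial τ R} :
    p ∈ weightsIn R v {k} ↔ IsWeightedHomogeneous v p k := Iff.rfl

/-- An additive family of sets of weights. -/
structure IsAdditive (A : ℕ → Set ℕ) : Prop where
  zero : 0 ∈ A 0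
  add : ∀ k l, ∀ i ∈ A k, ∀ j ∈ A l, i + j ∈ A (k + l)

/-- Four additive families occur: singletons for homogeneity, half-lines for lowest components,
residue classes for the invariance under g, and progressions for (iii). -/
theorem isAdditive_singleton : IsAdditive (fun k => {k}) := by
  constructor <;> simp

theorem isAdditive_Ici : IsAdditive Set.Ici :=
  ⟨le_refl 0, fun _ _ _ hi _ hj => add_le_add (Set.mem_Ici.1 hi) (Set.mem_Ici.1 hj)⟩

theorem isAdditive_modEq (N : ℕ) : IsAdditive (fun k => {i | i ≡ k [MOD N]}) :=
  ⟨Nat.ModEq.refl 0, fun _ _ _ hi _ hj => Nat.ModEq.add hi hj⟩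

theorem isAdditive_progression (N : ℕ) : IsAdditive (fun k => {i | ∃ j, i = k + N * j}) := by
  refine ⟨⟨0, by simp⟩, ?_⟩
  rintro k l _ ⟨i, rfl⟩ _ ⟨j, rfl⟩
  exact ⟨i + j, by ring⟩

theorem IsAdditive.pow_mem {A : ℕ → Set ℕ} (hA : IsAdditive A) {v : τ → ℕ}
    {p : MvPolynomial τ R} {k : ℕ} (hp : p ∈ weightsIn R v (A k)) (e : ℕ) :
    p ^ e ∈ weightsIn R v (A (e * k)) := by
  induction e with
  | zero => rw [pow_zero, zero_mul]; exact C_mem_weightsIn v hA.zero 1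
  | succ e ih => rw [pow_succ, Nat.succ_mul]; exact mul_mem_weightsIn (hA.add _ _) ih hp

theorem IsAdditive.prod_mem {A : ℕ → Set ℕ} (hA : IsAdditive A) {w : σ → ℕ} {v : τ → ℕ}
    {f : σ → MvPolynomial τ R} (hf : ∀ i, f i ∈ weightsIn R v (A (w i))) (m : σ →₀ ℕ) :
    m.prod (fun i k => f i ^ k) ∈ weightsIn R v (A (Finsupp.weight w m)) := by
  induction m using Finsupp.induction_linear with
  | zero => rw [Finsupp.prod_zero_index, map_zero]; exact C_mem_weightsIn v hA.zero 1
  | add m m' h h' =>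
    rw [Finsupp.prod_add_index' (fun _ => pow_zero _) (fun _ => pow_add _), map_add]
    exact mul_mem_weightsIn (hA.add _ _) h h'
  | single i e =>
    rw [Finsupp.prod_single_index (h := fun i k => _ ^ k) (pow_zero _), Finsupp.weight_single]
    exact hA.pow_mem (hf i) e

theorem IsAdditive.aeval_mem {A : ℕ → Set ℕ} (hA : IsAdditive A) {w : σ → ℕ} {v : τ → ℕ}
    {f : σ → MvPolynomial τ R} (hf : ∀ i, f i ∈ weightsIn R v (A (w i))) {B : Set ℕ}
    {D : Set ℕ} (hB : ∀ k ∈ D, A k ⊆ B) {p : MvPolynomial σ R} (hp : p ∈ weightsIn R w D) :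
    aeval f p ∈ weightsIn R v B := by
  rw [aeval_def, eval₂_eq]
  refine Submodule.sum_mem _ fun m hm => ?_
  rw [← Algebra.smul_def]
  refine Submodule.smul_mem _ _ (weightsIn_mono (hB _ (hp m (mem_support_iff.1 hm))) ?_)
  exact hA.prod_mem hf m

/-- Since `k` and `l` bound the weights from below, a term of weight `k + l` in the product arises
only from terms of weights exactly `k` and `l`. -/
theorem weightedHomogeneousComponent_mul {v : τ → ℕ} {k l : ℕ} {p p' : MvPolynomial τ R}
    (hp : p ∈ weightsIn R v (Set.Ici k)) (hp' : p' ∈ weightsIn R v (Set.Ici l)) :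
    weightedHomogeneousComponent v (k + l) (p * p') =
      weightedHomogeneousComponent v k p * weightedHomogeneousComponent v l p' := by
  classical
  ext m
  rw [coeff_weightedHomogeneousComponent, coeff_mul, coeff_mul]
  simp only [coeff_weightedHomogeneousComponent]
  split_ifs with hm
  · refine Finset.sum_congr rfl ?_
    rintro ⟨i, j⟩ hij
    rw [Finset.HasAntidiagonal.mem_antidiagonal] at hij
    have hw : Finsupp.weight v i + Finsupp.weight v j = k + l := by rw [← map_add, hij, hm]
    dsimp only
    by_cases hi : coeff i p = 0
    · simp [hi]
    by_cases hj : coeff j p' = 0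
    · simp [hj]
    have h1 := Set.mem_Ici.1 (hp i hi)
    have h2 := Set.mem_Ici.1 (hp' j hj)
    rw [if_pos (by omega), if_pos (by omega)]
  · refine (Finset.sum_eq_zero ?_).symm
    rintro ⟨i, j⟩ hij
    rw [Finset.HasAntidiagonal.mem_antidiagonal] at hij
    have hw : Finsupp.weight v i + Finsupp.weight v j = Finsupp.weight v m := by
      rw [← map_add, hij]
    dsimp only
    by_cases hi : Finsupp.weight v i = k
    · rw [if_neg (c := Finsupp.weight v j = l) (by omega), mul_zero]
    · rw [if_neg hi, zero_mul]

theorem weightedHomogeneousComponent_pow {v : τ → ℕ} {k : ℕ} {p : MvPolynomial τ R}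
    (hp : p ∈ weightsIn R v (Set.Ici k)) (e : ℕ) :
    weightedHomogeneousComponent v (e * k) (p ^ e) = weightedHomogeneousComponent v k p ^ e := by
  induction e with
  | zero =>
    rw [pow_zero, zero_mul, pow_zero]
    exact (isWeightedHomogeneous_one R v).weightedHomogeneousComponent_same
  | succ e ih =>
    rw [pow_succ, Nat.succ_mul, weightedHomogeneousComponent_mul (isAdditive_Ici.pow_mem hp e) hp,
      ih, pow_succ]

theorem weightedHomogeneousComponent_prod {w : σ → ℕ} {v : τ → ℕ} {f : σ → MvPolynomial τ R}
    (hf : ∀ i, f i ∈ weightsIn R v (Set.Ici (w i))) (m : σ →₀ ℕ) :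
    weightedHomogeneousComponent v (Finsupp.weight w m) (m.prod fun i k => f i ^ k) =
      m.prod fun i k => weightedHomogeneousComponent v (w i) (f i) ^ k := by
  induction m using Finsupp.induction_linear with
  | zero =>
    rw [Finsupp.prod_zero_index, Finsupp.prod_zero_index, map_zero]
    exact (isWeightedHomogeneous_one R v).weightedHomogeneousComponent_same
  | add m m' h h' =>
    rw [Finsupp.prod_add_index' (fun _ => pow_zero _) (fun _ => pow_add _),
      Finsupp.prod_add_index' (fun _ => pow_zero _) (fun _ => pow_add _), map_add,
      weightedHomogeneousComponent_mul (isAdditive_Ici.prod_mem hf m)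
        (isAdditive_Ici.prod_mem hf m'), h, h']
  | single i e =>
    rw [Finsupp.prod_single_index (h := fun i k => _ ^ k) (pow_zero _), Finsupp.prod_single_index (h := fun i k => _ ^ k) (pow_zero _),
      Finsupp.weight_single]
    exact weightedHomogeneousComponent_pow (hf i) e

/-- A substitution by weighted homogeneous polynomials commutes with taking components. -/
theorem weightedHomogeneousComponent_aeval {w : σ → ℕ} {v : τ → ℕ} {f : σ → MvPolynomial τ R}
    (hf : ∀ i, IsWeightedHomogeneous v (f i) (w i)) (k : ℕ) (p : MvPolynomial σ R) :
    weightedHomogeneousComponent v k (aeval f p) =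
      aeval f (weightedHomogeneousComponent w k p) := by
  induction p using MvPolynomial.induction_on' with
  | monomial m c =>
    have h1 : IsWeightedHomogeneous v (aeval f (MvPolynomial.monomial m c))
        (Finsupp.weight w m) := by
      rw [aeval_monomial, ← Algebra.smul_def]
      exact Submodule.smul_mem (weightsIn R v {_}) c (isAdditive_singleton.prod_mem hf m)
    have h2 := isWeightedHomogeneous_monomial (R := R) w m c rfl
    by_cases hk : k = Finsupp.weight w m
    · subst hk
      rw [h1.weightedHomogeneousComponent_same, h2.weightedHomogeneousComponent_same]
    · rw [h1.weightedHomogeneousComponent_ne k hk, h2.weightedHomogeneousComponent_ne k hk,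
        map_zero]
  | add p p' h h' => simp only [map_add, h, h']

end Weights

/-! ### Weighted homogeneous substitutions -/

section Bijectivity

variable {σ R : Type*} [CommRing R]

/-- The kernels of the powers of `f` stabilize at some `k`. Writing an element of ker f as f^k(b)
puts b in ker f^(k+1) = ker f^k, so the element is 0. -/
theorem _root_.AlgHom.injective_of_surjective_of_isNoetherianRing {A : Type*} [CommRing A]
    [Algebra R A] [IsNoetherianRing A] (f : A →ₐ[R] A) (hf : Function.Surjective f) :
    Function.Injective f := by
  let F : ℕ →o Ideal A :=
    { toFun := fun k => RingHom.ker (f ^ k)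
      monotone' := monotone_nat_of_le_succ fun k a ha => by
        rw [RingHom.mem_ker] at ha ⊢
        rw [pow_succ', AlgHom.mul_apply, ha, map_zero] }
  obtain ⟨k, hk⟩ := monotone_stabilizes_iff_noetherian.2 ‹IsNoetherianRing A› F
  have hs : Function.Surjective (f ^ k) := by
    rw [AlgHom.coe_pow]
    exact hf.iterate k
  rw [injective_iff_map_eq_zero]
  intro a ha
  obtain ⟨b, rfl⟩ := hs a
  have h1 : b ∈ F (k + 1) := by
    change b ∈ RingHom.ker (f ^ (k + 1))
    rw [RingHom.mem_ker, pow_succ', AlgHom.mul_apply, ha]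
  rw [← hk (k + 1) (Nat.le_succ k)] at h1
  exact (RingHom.mem_ker).1 h1

/-- A weighted homogeneous substitution with invertible linear part is bijective. -/
theorem bijective_aeval_of_isUnit_linearPart [IsNoetherianRing R] [Fintype σ] [DecidableEq σ]
    {w : σ → ℕ} (hw : ∀ i, 0 < w i) {f : σ → MvPolynomial σ R}
    (hf : ∀ i, IsWeightedHomogeneous w (f i) (w i))
    (hJ : IsUnit (Matrix.of fun i j => coeff (Finsupp.single j 1) (f i))) :
    Function.Bijective (aeval f : MvPolynomial σ R →ₐ[R] MvPolynomial σ R) := by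
  have hs : Function.Surjective (aeval f : MvPolynomial σ R →ₐ[R] MvPolynomial σ R) := by
    rw [← AlgHom.range_eq_top, eq_top_iff, ← adjoin_range_X, Algebra.adjoin_le_iff]
    rintro _ ⟨j, rfl⟩
    -- Each variable is reached by strong induction on its weight.
    suffices H : ∀ k, ∀ j, w j = k → (X j : MvPolynomial σ R) ∈
        (aeval f : MvPolynomial σ R →ₐ[R] MvPolynomial σ R).range from H _ j rfl
    clear j
    intro k
    induction k using Nat.strong_induction_on with
    | _ k ih =>
    intro j hj
    set J : Matrix σ σ R := Matrix.of fun i j => coeff (Finsupp.single j 1) (f i) with hJdef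
    obtain ⟨u, hu⟩ := hJ
    set I : Matrix σ σ R := ↑u⁻¹ with hI
    have hIJ : I * J = 1 := by rw [← hu, hI, Units.inv_mul]
    -- Row `j` of the inverse of `J`, restricted to the `f i` of weight `w j`: this keeps `M`
    -- homogeneous, and its linear part is still `X j`, because an `f i` of another weight has no
    -- linear term in a variable of weight `w j`.
    set M : MvPolynomial σ R := ∑ i, if w i = w j then I j i • f i else 0 with hM
    have hMr : M ∈ (aeval f : MvPolynomial σ R →ₐ[R] MvPolynomial σ R).range := by
      refine Subalgebra.sum_mem _ fun i _ => ?_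
      split_ifs
      · exact Subalgebra.smul_mem _ (AlgHom.mem_range _ |>.2 ⟨X i, aeval_X _ _⟩) _
      · exact Subalgebra.zero_mem _
    have hMh : IsWeightedHomogeneous w M (w j) := by
      refine Submodule.sum_mem (weightsIn R w {w j}) fun i _ => ?_
      split_ifs with h
      · exact Submodule.smul_mem _ _ (h ▸ hf i)
      · exact Submodule.zero_mem _
    have hMl : ∀ l, coeff (Finsupp.single l 1) M = if j = l then 1 else 0 := by
      intro l
      have h1 : (I * J) j l = if j = l then 1 else 0 := by rw [hIJ, Matrix.one_apply]
      by_cases hl : w l = w j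
      · rw [← h1, hM, coeff_sum, Matrix.mul_apply]
        refine Finset.sum_congr rfl fun i _ => ?_
        split_ifs with h
        · rw [coeff_smul, smul_eq_mul, hJdef, Matrix.of_apply]
        · have : coeff (Finsupp.single l 1) (f i) = 0 := by
            refine (hf i).coeff_eq_zero _ ?_
            rw [Finsupp.weight_single, one_smul]
            exact fun h' => h (h'.symm.trans hl)
          rw [coeff_zero, hJdef, Matrix.of_apply, this, mul_zero]
      · rw [if_neg (fun h => hl (by rw [h]))]
        refine hMh.coeff_eq_zero _ ?_
        rwa [Finsupp.weight_single, one_smul]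
    -- Monomials here have weight `w j` and are not single variables, so with positive weights every
    -- variable in them is lighter than `X j` and the induction applies.
    have hdiff : M - X j ∈ (aeval f : MvPolynomial σ R →ₐ[R] MvPolynomial σ R).range := by
      rw [MvPolynomial.as_sum (M - X j)]
      refine Subalgebra.sum_mem _ fun m hm => ?_
      rw [MvPolynomial.mem_support_iff] at hm
      have hmw : Finsupp.weight w m = w j := hMh.sub (isWeightedHomogeneous_X R w j) hm
      rw [monomial_eq, ← algebraMap_eq]
      refine Subalgebra.mul_mem _ (Subalgebra.algebraMap_mem _ _) ?_
      refine Subalgebra.prod_mem _ fun i hi => Subalgebra.pow_mem _ (ih (w i) ?_ i rfl) _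
      have hi0 : 1 ≤ m i := Nat.one_le_iff_ne_zero.2 (Finsupp.mem_support_iff.1 hi)
      rw [← hj, ← hmw]
      obtain ⟨m', rfl⟩ : ∃ m', m = Finsupp.single i 1 + m' :=
        ⟨m - Finsupp.single i 1, (add_tsub_cancel_of_le (Finsupp.single_le_iff.2 hi0)).symm⟩
      rw [map_add, Finsupp.weight_single, one_smul, lt_add_iff_pos_right, Nat.pos_iff_ne_zero]
      intro h0
      have : m' = 0 := by
        ext l
        by_contra hl
        have h2 := Finsupp.le_weight w (hw l).ne' m'
        simp only [Finsupp.coe_zero, Pi.zero_apply] at hl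
        omega
      rw [this, add_zero, coeff_sub, hMl, coeff_X] at hm
      refine hm ?_
      by_cases hij : j = i
      · simp [hij]
      · simp [hij, Finsupp.single_left_inj]
    have := Subalgebra.sub_mem _ hMr hdiff
    rwa [sub_sub_cancel] at this
  exact ⟨AlgHom.injective_of_surjective_of_isNoetherianRing _ hs, hs⟩

end Bijectivity

/-! ### Translation and derivatives of polynomials -/

section Taylor

variable {σ R : Type*} [CommRing R]

/-- The polynomial `p (X + c)`. -/
noncomputable def taylorShift (c : σ → R) : MvPolynomial σ R →ₐ[R] MvPolynomial σ R :=
  aeval fun i => X i + C (c i)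

theorem constantCoeff_taylorShift (c : σ → R) (p : MvPolynomial σ R) :
    constantCoeff (taylorShift c p) = aeval c p := by
  induction p using MvPolynomial.induction_on with
  | C a => simp [taylorShift]
  | add p p' h h' => simp only [map_add, h, h']
  | mul_X p i h => simp only [map_mul, h]; simp [taylorShift]

theorem pderiv_taylorShift (c : σ → R) (i : σ) (p : MvPolynomial σ R) :
    pderiv i (taylorShift c p) = taylorShift c (pderiv i p) := by
  classical
  induction p using MvPolynomial.induction_on with
  | C a => simp [taylorShift]
  | add p p' h h' => simp only [map_add, h, h']
  | mul_X p j h =>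
    rw [map_mul, Derivation.leibniz, Derivation.leibniz, h, map_add]
    have hX : taylorShift c (X j) = X j + C (c j) := aeval_X _ _
    simp only [smul_eq_mul, map_mul, map_add, hX, pderiv_C, add_zero, pderiv_X]
    congr 2
    by_cases hij : i = j
    · subst hij; simp
    · simp [Pi.single_eq_of_ne' hij]

theorem coeff_pderiv_pow (i : σ) (k : ℕ) (p : MvPolynomial σ R) (m : σ →₀ ℕ) (hm : m i = 0) :
    coeff m (((pderiv i).toLinearMap ^ k : Module.End R (MvPolynomial σ R)) p) =
      coeff (m + Finsupp.single i k) p * (k.factorial : R) := by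
  -- The induction needs an arbitrary starting exponent `l`; the factor is then (l+1)⋯(l+k), which
  -- is k! at l = 0.
  suffices H : ∀ k, ∀ p : MvPolynomial σ R, ∀ l,
      coeff (m + Finsupp.single i l) (((pderiv i).toLinearMap ^ k :
        Module.End R (MvPolynomial σ R)) p) =
      coeff (m + Finsupp.single i (l + k)) p * ((l + 1).ascFactorial k : R) by
    simpa [Nat.one_ascFactorial] using H k p 0
  clear k p
  intro k
  induction k with
  | zero => simp
  | succ k ih =>
    intro p l
    rw [pow_succ, Module.End.mul_apply, ih]
    change coeff _ (pderiv i p) * _ = _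
    rw [coeff_pderiv, add_assoc, ← Finsupp.single_add, Nat.ascFactorial_succ, mul_assoc]
    simp only [Finsupp.add_apply, hm, Finsupp.single_eq_same]
    push_cast
    ring_nf

theorem coeff_prod_pderiv_pow (b : σ →₀ ℕ) (l : List σ) (hl : l.Nodup) (p : MvPolynomial σ R)
    (m : σ →₀ ℕ) (hm : ∀ i ∈ l, m i = 0) :
    coeff m ((l.map fun i => ((pderiv i).toLinearMap ^ b i :
        Module.End R (MvPolynomial σ R))).prod p) =
      coeff (m + (l.map fun i => Finsupp.single i (b i)).sum) p *
        ((l.map fun i => (b i).factorial).prod : ℕ) := by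
  classical
  induction l generalizing m with
  | nil => simp
  | cons i l ih =>
    rw [List.nodup_cons] at hl
    simp only [List.map_cons, List.prod_cons, List.sum_cons, Module.End.mul_apply]
    rw [coeff_pderiv_pow i (b i) _ m (hm i List.mem_cons_self), ih hl.2]
    · push_cast
      rw [add_assoc]
      ring
    · intro j hj
      have hij : i ≠ j := fun h => hl.1 (h ▸ hj)
      rw [Finsupp.add_apply, hm j (List.mem_cons_of_mem _ hj), Finsupp.single_eq_of_ne' hij,
        add_zero]

end Taylor

/-! ### Taylor expansion at q in the coordinates z -/

section Coordinates

variable {V : Type*} [AddCommGroup V] [Module ℂ V] {n : ℕ}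

theorem evalAt_lin (v : V) (l : Dual ℂ V) : evalAt v (lin l) = l v := by
  simp [evalAt]

/-- The Taylor expansion at `q` in the coordinates `z`. -/
noncomputable def taylorAt (z : Basis (Fin n) ℂ (Dual ℂ V)) (q : V) :
    PolyAlg V →ₐ[ℂ] MvPolynomial (Fin n) ℂ :=
  (taylorShift fun i => z i q).comp (SymmetricAlgebra.equivMvPolynomial z).toAlgHom

theorem taylorAt_apply (z : Basis (Fin n) ℂ (Dual ℂ V)) (q : V) (F : PolyAlg V) :
    taylorAt z q F = taylorShift (fun i => z i q) (SymmetricAlgebra.equivMvPolynomial z F) := rfl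

theorem algHom_ext_basis (z : Basis (Fin n) ℂ (Dual ℂ V)) {A : Type*} [CommRing A] [Algebra ℂ A]
    {f f' : PolyAlg V →ₐ[ℂ] A} (h : ∀ i, f (lin (z i)) = f' (lin (z i))) : f = f' :=
  SymmetricAlgebra.algHom_ext (z.ext h)

theorem constantCoeff_taylorAt (z : Basis (Fin n) ℂ (Dual ℂ V)) (q : V) (F : PolyAlg V) :
    constantCoeff (taylorAt z q F) = evalAt q F := by
  rw [taylorAt_apply, constantCoeff_taylorShift]
  have : (aeval fun i => z i q).comp (SymmetricAlgebra.equivMvPolynomial z).toAlgHom =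
      evalAt q := by
    refine algHom_ext_basis z fun i => ?_
    rw [evalAt_lin]
    simp
  exact DFunLike.congr_fun this F

theorem equivMvPolynomial_partialDeriv (z : Basis (Fin n) ℂ (Dual ℂ V)) (i : Fin n)
    (F : PolyAlg V) :
    SymmetricAlgebra.equivMvPolynomial z (partialDeriv z i F) =
      pderiv i (SymmetricAlgebra.equivMvPolynomial z F) := by
  simp [partialDeriv]

theorem evalAt_partialDeriv (z : Basis (Fin n) ℂ (Dual ℂ V)) (q : V) (i : Fin n)
    (F : PolyAlg V) :
    evalAt q (partialDeriv z i F) = coeff (Finsupp.single i 1) (taylorAt z q F) := by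
  rw [← constantCoeff_taylorAt z, taylorAt_apply, equivMvPolynomial_partialDeriv,
    ← pderiv_taylorShift, constantCoeff_eq, coeff_pderiv, ← taylorAt_apply]
  simp

theorem taylorAt_iterDeriv (z : Basis (Fin n) ℂ (Dual ℂ V)) (q : V) (b : Fin n →₀ ℕ)
    (F : PolyAlg V) :
    taylorAt z q (iterDeriv z b F) =
      ((List.finRange n).map fun i => ((pderiv i).toLinearMap ^ b i :
        Module.End ℂ (MvPolynomial (Fin n) ℂ))).prod (taylorAt z q F) := by
  have h1 : ∀ i, ∀ F, taylorAt z q (partialDeriv z i F) = pderiv i (taylorAt z q F) := by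
    intro i F
    rw [taylorAt_apply, equivMvPolynomial_partialDeriv, ← pderiv_taylorShift, taylorAt_apply]
  have h2 : ∀ i, ∀ k, ∀ F, taylorAt z q ((partialDeriv z i ^ k) F) =
      ((pderiv i).toLinearMap ^ k : Module.End ℂ (MvPolynomial (Fin n) ℂ)) (taylorAt z q F) := by
    intro i k
    induction k with
    | zero => intro F; rfl
    | succ k ih =>
      intro F
      rw [pow_succ, pow_succ, Module.End.mul_apply, Module.End.mul_apply, ih, h1]
      rfl
  rw [iterDeriv, List.ofFn_eq_map]
  generalize List.finRange n = l
  induction l with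
  | nil => rfl
  | cons i l ih =>
    rw [List.map_cons, List.prod_cons, List.map_cons, List.prod_cons, Module.End.mul_apply,
      Module.End.mul_apply, h2, ih]

/-- Derivatives commute with translation, and the value at q is the constant Taylor coefficient. All
conditions on derivatives at q thus become conditions on coefficients. -/
theorem evalAt_iterDeriv (z : Basis (Fin n) ℂ (Dual ℂ V)) (q : V) (b : Fin n →₀ ℕ)
    (F : PolyAlg V) :
    evalAt q (iterDeriv z b F) = (multiFactorial b : ℂ) * coeff b (taylorAt z q F) := by
  rw [← constantCoeff_taylorAt z, taylorAt_iterDeriv, constantCoeff_eq,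
    coeff_prod_pderiv_pow b _ (List.nodup_finRange n) _ 0 (fun _ _ => rfl), zero_add, mul_comm,
    ← List.ofFn_eq_map, ← List.ofFn_eq_map, List.prod_ofFn, List.sum_ofFn,
    Finsupp.univ_sum_single]
  rfl

theorem multiFactorial_ne_zero (b : Fin n →₀ ℕ) : (multiFactorial b : ℂ) ≠ 0 :=
  Nat.cast_ne_zero.2 (Finset.prod_ne_zero_iff.2 fun _ _ => Nat.factorial_ne_zero _)

theorem one_div_multiFactorial_mul_evalAt (z : Basis (Fin n) ℂ (Dual ℂ V)) (q : V)
    (b : Fin n →₀ ℕ) (F : PolyAlg V) :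
    (1 / (multiFactorial b : ℂ)) * evalAt q (iterDeriv z b F) = coeff b (taylorAt z q F) := by
  rw [evalAt_iterDeriv, ← mul_assoc, one_div_mul_cancel (multiFactorial_ne_zero b), one_mul]

theorem wdeg_eq_weight (d : Fin n → ℕ) (b : Fin n →₀ ℕ) : wdeg d b = Finsupp.weight d b := by
  rw [Finsupp.weight_eq_sum, wdeg]
  exact Finset.sum_congr rfl fun i _ => by rw [smul_eq_mul, mul_comm]

theorem size_eq_weight (b : Fin n →₀ ℕ) : size b = Finsupp.weight (fun _ => 1) b := by
  rw [Finsupp.weight_eq_sum, size]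
  exact Finset.sum_congr rfl fun i _ => by rw [smul_eq_mul, mul_one]

theorem equivMvPolynomial_monomial (z : Basis (Fin n) ℂ (Dual ℂ V)) (b : Fin n →₀ ℕ) :
    SymmetricAlgebra.equivMvPolynomial z (monomial z b) = MvPolynomial.monomial b 1 := by
  rw [monomial_eq, C_1, one_mul, Finsupp.prod_fintype _ _ (fun _ => pow_zero _)]
  simp [monomial]

theorem lin_eq_sum (z : Basis (Fin n) ℂ (Dual ℂ V)) (l : Dual ℂ V) :
    lin l = ∑ i, z.repr l i • lin (z i) := by
  conv_lhs => rw [← z.sum_repr l]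
  rw [map_sum]
  exact Finset.sum_congr rfl fun i _ => map_smul _ _ _

theorem equivMvPolynomial_lin (z : Basis (Fin n) ℂ (Dual ℂ V)) (l : Dual ℂ V) :
    SymmetricAlgebra.equivMvPolynomial z (lin l) = ∑ i, z.repr l i • X i := by
  rw [lin_eq_sum z, map_sum]
  simp

theorem isWeightedHomogeneous_of_mem_dualPart_pow (z : Basis (Fin n) ℂ (Dual ℂ V)) {k : ℕ}
    {F : PolyAlg V} (hF : F ∈ dualPart V ^ k) :
    IsWeightedHomogeneous (fun _ => 1) (SymmetricAlgebra.equivMvPolynomial z F) k := by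
  rw [← mem_weightsIn_singleton]
  induction hF using Submodule.pow_induction_on_left' with
  | algebraMap c =>
    rw [AlgEquiv.commutes, algebraMap_eq]
    exact C_mem_weightsIn _ (Set.mem_singleton 0) c
  | add F F' i _ _ h h' =>
    rw [map_add]
    exact Submodule.add_mem _ h h'
  | mem_mul F hF i F' _ h =>
    obtain ⟨l, rfl⟩ := hF
    rw [map_mul, equivMvPolynomial_lin, Nat.succ_eq_add_one, add_comm]
    refine mul_mem_weightsIn (isAdditive_singleton.add 1 i) ?_ h
    exact Submodule.sum_mem _ fun j _ => Submodule.smul_mem _ _ (X_mem_weightsIn rfl)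

theorem mem_dualPart_iff (z : Basis (Fin n) ℂ (Dual ℂ V)) (F : PolyAlg V) :
    F ∈ dualPart V ↔
      IsWeightedHomogeneous (fun _ => 1) (SymmetricAlgebra.equivMvPolynomial z F) 1 := by
  refine ⟨fun h => isWeightedHomogeneous_of_mem_dualPart_pow z (by rwa [pow_one]), fun h => ?_⟩
  rw [← (SymmetricAlgebra.equivMvPolynomial z).symm_apply_apply F,
    MvPolynomial.as_sum (SymmetricAlgebra.equivMvPolynomial z F), map_sum]
  refine Submodule.sum_mem _ fun m hm => ?_
  have h1 := h (MvPolynomial.mem_support_iff.1 hm)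
  have h2 : m.degree = 1 := by
    rw [Finsupp.degree_eq_weight_one]
    exact h1
  obtain ⟨i, rfl⟩ : m ∈ Set.range fun i : Fin n => Finsupp.single i 1 := by
    rw [Finsupp.range_single_one]
    exact h2
  rw [← mul_one (coeff _ _), ← smul_eq_mul, ← smul_monomial, map_smul]
  refine Submodule.smul_mem _ _ ⟨z i, ?_⟩
  exact (SymmetricAlgebra.equivMvPolynomial_symm_X z i).symm

theorem lin_injective :
    Function.Injective (lin : Dual ℂ V → PolyAlg V) := by
  rw [injective_iff_map_eq_zero]
  intro l hl
  ext v
  rw [← evalAt_lin, hl, map_zero, LinearMap.zero_apply]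

theorem partialDeriv_mul (z : Basis (Fin n) ℂ (Dual ℂ V)) (i : Fin n) (F F' : PolyAlg V) :
    partialDeriv z i (F * F') = F * partialDeriv z i F' + F' * partialDeriv z i F := by
  apply (SymmetricAlgebra.equivMvPolynomial z).injective
  simp only [equivMvPolynomial_partialDeriv, map_mul, map_add, Derivation.leibniz, smul_eq_mul]

theorem partialDeriv_lin (z : Basis (Fin n) ℂ (Dual ℂ V)) (i : Fin n) (l : Dual ℂ V) :
    partialDeriv z i (lin l) = algebraMap ℂ _ (z.repr l i) := by
  classical
  apply (SymmetricAlgebra.equivMvPolynomial z).injective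
  rw [equivMvPolynomial_partialDeriv, equivMvPolynomial_lin, AlgEquiv.commutes, map_sum,
    Finset.sum_eq_single i]
  · rw [Derivation.map_smul, pderiv_X_self, Algebra.algebraMap_eq_smul_one]
  · intro j _ hj
    rw [Derivation.map_smul, pderiv_X_of_ne hj, smul_zero]
  · simp

/-- A linear functional satisfying the Leibniz rule at `q`. -/
structure IsPointDerivation (q : V) (D : PolyAlg V →ₗ[ℂ] ℂ) : Prop where
  leibniz : ∀ F F', D (F * F') = evalAt q F * D F' + evalAt q F' * D F

theorem IsPointDerivation.map_algebraMap {q : V} {D : PolyAlg V →ₗ[ℂ] ℂ}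
    (hD : IsPointDerivation q D) (c : ℂ) : D (algebraMap ℂ _ c) = 0 := by
  have h := hD.leibniz 1 1
  rw [mul_one, map_one (evalAt q), one_mul, left_eq_add] at h
  rw [Algebra.algebraMap_eq_smul_one, map_smul, h, smul_zero]

/-- Both sides obey the Leibniz rule at q and agree on linear forms: a tangent vector is determined
by its values on coordinates. -/
theorem IsPointDerivation.eq_sum {q : V} {D : PolyAlg V →ₗ[ℂ] ℂ} (hD : IsPointDerivation q D)
    (z : Basis (Fin n) ℂ (Dual ℂ V)) (F : PolyAlg V) :
    D F = ∑ i, evalAt q (partialDeriv z i F) * D (lin (z i)) := by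
  induction F using SymmetricAlgebra.induction with
  | algebraMap c =>
    rw [hD.map_algebraMap, Finset.sum_eq_zero]
    intro i _
    have : partialDeriv z i (algebraMap ℂ (PolyAlg V) c) = 0 := by
      apply (SymmetricAlgebra.equivMvPolynomial z).injective
      rw [equivMvPolynomial_partialDeriv, AlgEquiv.commutes, algebraMap_eq, pderiv_C, map_zero]
    rw [this, map_zero, zero_mul]
  | ι l =>
    simp only [partialDeriv_lin, AlgHom.commutes, Algebra.algebraMap_self, RingHom.id_apply]
    rw [lin_eq_sum z, map_sum]
    exact Finset.sum_congr rfl fun i _ => map_smul _ _ _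
  | mul F F' h h' =>
    rw [hD.leibniz, h, h', Finset.mul_sum, Finset.mul_sum, ← Finset.sum_add_distrib]
    refine Finset.sum_congr rfl fun i _ => ?_
    rw [partialDeriv_mul, map_add, map_mul, map_mul]
    ring
  | add F F' h h' =>
    rw [map_add, h, h', ← Finset.sum_add_distrib]
    refine Finset.sum_congr rfl fun i _ => ?_
    rw [map_add, map_add, add_mul]

end Coordinates

/-! ### Basic invariants, their Jacobian matrix and their leading parts -/

section Invariants

variable {V : Type*} [AddCommGroup V] [Module ℂ V] {n : ℕ} {G : Subgroup (V ≃ₗ[ℂ] V)}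
  {d : Fin n → ℕ} {x : Fin n → invariants G}

theorem IsBasicInvariants.induction (hx : IsBasicInvariants G d x)
    {motive : PolyAlg V → Prop} (gen : ∀ α, motive (x α))
    (const : ∀ c, motive (algebraMap ℂ _ c)) (add : ∀ F F', motive F → motive F' → motive (F + F'))
    (mul : ∀ F F', motive F → motive F' → motive (F * F')) (F : invariants G) :
    motive F := by
  have hF : F ∈ Algebra.adjoin ℂ (Set.range x) := by rw [hx.adjoin_eq_top]; trivial
  induction hF using Algebra.adjoin_induction with
  | mem F hF => obtain ⟨α, rfl⟩ := hF; exact gen α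
  | algebraMap c => exact const c
  | add F F' _ _ h h' => exact add _ _ h h'
  | mul F F' _ _ h h' => exact mul _ _ h h'

/-- Invertibility of the Jacobian matrix depends neither on the basic invariants nor on the
coordinates. -/
theorem IsBasicInvariants.isUnit_jacobian {y : Fin n → invariants G}
    (hy : IsBasicInvariants G d y) {q : V} {z₀ : Basis (Fin n) ℂ (Dual ℂ V)}
    (h : IsUnit (jacobian x z₀ q)) (z : Basis (Fin n) ℂ (Dual ℂ V)) :
    IsUnit (jacobian y z q) := by
  rw [← Matrix.mulVec_injective_iff_isUnit] at h ⊢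
  rw [← Matrix.coe_mulVecLin, injective_iff_map_eq_zero] at h ⊢
  intro v hv
  -- A kernel vector of the Jacobian matrix of `y`, viewed as a tangent vector at q. It kills the
  -- generators `y`, hence all invariants, in particular `x`; so its coordinates in `z₀` lie in the
  -- zero kernel of the Jacobian matrix of `x`.
  let D : PolyAlg V →ₗ[ℂ] ℂ := ∑ i, v i • ((evalAt q).toLinearMap ∘ₗ partialDeriv z i)
  have hDapp : ∀ F, D F = ∑ i, v i * evalAt q (partialDeriv z i F) := fun F => by simp [D]
  have hD : IsPointDerivation q D := by
    constructor
    intro F F'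
    rw [hDapp, hDapp, hDapp, Finset.mul_sum, Finset.mul_sum, ← Finset.sum_add_distrib]
    refine Finset.sum_congr rfl fun i _ => ?_
    rw [partialDeriv_mul, map_add, map_mul, map_mul]
    ring
  have hD0 : ∀ F : invariants G, D F = 0 := by
    refine hy.induction (motive := fun F => D F = 0) (fun α => ?_) hD.map_algebraMap (fun F F' h h' => ?_)
      (fun F F' h h' => ?_)
    · have := congrFun hv α
      simp only [Matrix.mulVecLin_apply, Matrix.mulVec, dotProduct, jacobian, Matrix.of_apply,
        Pi.zero_apply] at this
      rw [hDapp, ← this]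
      exact Finset.sum_congr rfl fun i _ => mul_comm _ _
    · rw [map_add, h, h', add_zero]
    · rw [hD.leibniz, h, h', mul_zero, mul_zero, add_zero]
  have hu := h (fun i => D (lin (z₀ i))) (by
    ext α
    have := hD.eq_sum z₀ (x α)
    rw [hD0] at this
    simp only [Matrix.mulVecLin_apply, Matrix.mulVec, dotProduct, jacobian, Matrix.of_apply,
      Pi.zero_apply, ← this])
  have hDz : ∀ F, D F = 0 := fun F => by
    rw [hD.eq_sum z₀ F]
    exact Finset.sum_eq_zero fun i _ => by rw [congrFun hu i, Pi.zero_apply, mul_zero]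
  ext i
  have := hDz (lin (z i))
  rw [hDapp, Finset.sum_eq_single i] at this
  · simpa [partialDeriv_lin] using this
  · intro j _ hj
    simp [partialDeriv_lin, hj.symm]
  · simp

/-- A generator of degree 0 would be a scalar, against algebraic independence. -/
theorem IsBasicInvariants.degree_pos (hx : IsBasicInvariants G d x) (α : Fin n) : 0 < d α := by
  rw [Nat.pos_iff_ne_zero]
  intro h
  have h1 := hx.homogeneous α
  rw [h, pow_zero, Submodule.mem_one] at h1
  obtain ⟨c, hc⟩ := h1
  have h2 : aeval x (C c : MvPolynomial (Fin n) ℂ) = aeval x (X α : MvPolynomial (Fin n) ℂ) := by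
    rw [aeval_X, ← algebraMap_eq, AlgHom.commutes]
    exact Subtype.ext hc
  have h3 := congrArg (coeff (Finsupp.single α 1)) (hx.algebraicIndependent h2)
  rw [coeff_X, if_pos rfl, coeff_C,
    if_neg (Finsupp.single_ne_zero.2 one_ne_zero).symm] at h3
  exact zero_ne_one h3

theorem IsBasicInvariants.exists_aeval_eq (hx : IsBasicInvariants G d x) (F : invariants G) :
    ∃ p : MvPolynomial (Fin n) ℂ, aeval x p = F := by
  have hF : F ∈ Algebra.adjoin ℂ (Set.range x) := by rw [hx.adjoin_eq_top]; trivial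
  rw [Algebra.adjoin_range_eq_range_aeval] at hF
  exact hF

theorem coe_aeval (x : Fin n → invariants G) (p : MvPolynomial (Fin n) ℂ) :
    ((aeval x p : invariants G) : PolyAlg V) = aeval (fun i => (x i : PolyAlg V)) p :=
  comp_aeval_apply x (invariants G).val p

theorem map_coe_aeval {A : Type*} [CommRing A] [Algebra ℂ A] (f : PolyAlg V →ₐ[ℂ] A)
    (x : Fin n → invariants G) (p : MvPolynomial (Fin n) ℂ) :
    f (aeval x p : invariants G) = aeval (fun i => f (x i)) p := by
  rw [coe_aeval]
  exact comp_aeval_apply _ f p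

/-- Homogeneous invariants are weighted homogeneous polynomials in basic invariants. -/
theorem IsBasicInvariants.exists_isWeightedHomogeneous (hx : IsBasicInvariants G d x)
    (z : Basis (Fin n) ℂ (Dual ℂ V)) {k : ℕ} {F : invariants G}
    (hF : (F : PolyAlg V) ∈ dualPart V ^ k) :
    ∃ p : MvPolynomial (Fin n) ℂ, IsWeightedHomogeneous d p k ∧ aeval x p = F := by
  obtain ⟨p, rfl⟩ := hx.exists_aeval_eq F
  -- Substituting the homogeneous `x` commutes with taking components, so the other components of
  -- `p` contribute nothing.
  refine ⟨weightedHomogeneousComponent d k p,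
    weightedHomogeneousComponent_isWeightedHomogeneous k p, Subtype.ext ?_⟩
  apply (SymmetricAlgebra.equivMvPolynomial z).injective
  have h1 := (isWeightedHomogeneous_of_mem_dualPart_pow z hF).weightedHomogeneousComponent_same
  have h2 : ∀ p, SymmetricAlgebra.equivMvPolynomial z (aeval x p : invariants G) =
      aeval (fun i => SymmetricAlgebra.equivMvPolynomial z (x i)) p := fun p =>
    map_coe_aeval (SymmetricAlgebra.equivMvPolynomial z).toAlgHom x p
  rw [h2] at h1 ⊢
  rw [h2, ← h1, weightedHomogeneousComponent_aeval
    (fun i => isWeightedHomogeneous_of_mem_dualPart_pow z (hx.homogeneous i))]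

theorem coe_aeval_mem_dualPart_pow (h : ∀ α, (x α : PolyAlg V) ∈ dualPart V ^ d α) {k : ℕ}
    {p : MvPolynomial (Fin n) ℂ} (hp : IsWeightedHomogeneous d p k) :
    ((aeval x p : invariants G) : PolyAlg V) ∈ dualPart V ^ k := by
  rw [coe_aeval, aeval_def, eval₂_eq]
  refine Submodule.sum_mem _ fun m hm => ?_
  rw [← Algebra.smul_def, ← hp (MvPolynomial.mem_support_iff.1 hm)]
  refine Submodule.smul_mem _ _ ?_
  change m.prod (fun i e => (x i : PolyAlg V) ^ e) ∈ _
  clear hm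
  induction m using Finsupp.induction_linear with
  | zero => rw [Finsupp.prod_zero_index, map_zero, pow_zero]; exact Submodule.one_le.1 le_rfl
  | add m m' h h' =>
    rw [Finsupp.prod_add_index' (fun _ => pow_zero _) (fun _ => pow_add _), map_add, pow_add]
    exact Submodule.mul_mem_mul h h'
  | single i e =>
    rw [Finsupp.prod_single_index (h := fun i e => _ ^ e) (pow_zero _), Finsupp.weight_single,
      smul_eq_mul, mul_comm, pow_mul]
    exact Submodule.pow_mem_pow _ (h i) e

/-- The part of `x α` of weight `d α` in the Taylor expansion at `q`. -/
noncomputable def leadingPart (d : Fin n → ℕ) (x : Fin n → invariants G)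
    (z : Basis (Fin n) ℂ (Dual ℂ V)) (q : V) (α : Fin n) : MvPolynomial (Fin n) ℂ :=
  weightedHomogeneousComponent d (d α) (taylorAt z q (x α))

theorem isWeightedHomogeneous_leadingPart (z : Basis (Fin n) ℂ (Dual ℂ V)) (q : V) (α : Fin n) :
    IsWeightedHomogeneous d (leadingPart d x z q α) (d α) :=
  weightedHomogeneousComponent_isWeightedHomogeneous _ _

theorem taylorAt_shiftedMonomial (z : Basis (Fin n) ℂ (Dual ℂ V)) (q : V) (a : Fin n →₀ ℕ) :
    taylorAt z q (shiftedMonomial x q a) =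
      a.prod fun i k => (taylorAt z q (x i) - C (evalAt q (x i))) ^ k := by
  rw [shiftedMonomial, map_prod, Finsupp.prod_fintype _ _ (fun _ => pow_zero _)]
  simp only [map_pow, map_sub, AlgHom.commutes, algebraMap_eq]

end Invariants

/-! ### The map ψ as passage to leading parts -/

section Psi

variable {V : Type*} [AddCommGroup V] [Module ℂ V] {n : ℕ} {G : Subgroup (V ≃ₗ[ℂ] V)}
  {d : Fin n → ℕ} {x : Fin n → invariants G}

theorem coeff_aeval_C_mul_X {σ R : Type*} [CommRing R] (u : σ → R) (p : MvPolynomial σ R)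
    (m : σ →₀ ℕ) :
    coeff m (aeval (fun i => C (u i) * X i) p) = (m.prod fun i k => u i ^ k) * coeff m p := by
  classical
  induction p using MvPolynomial.induction_on' with
  | monomial s c =>
    have : aeval (fun i => C (u i) * X i : σ → MvPolynomial σ R) (MvPolynomial.monomial s c) =
        MvPolynomial.monomial s ((s.prod fun i k => u i ^ k) * c) := by
      rw [aeval_monomial, monomial_eq]
      simp only [mul_pow, algebraMap_eq, Finsupp.prod, map_mul, map_prod, map_pow,
        Finset.prod_mul_distrib]
      ring
    rw [this, coeff_monomial, coeff_monomial]
    split_ifs with h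
    · rw [h]
    · rw [mul_zero]
  | add p p' h h' => rw [map_add, coeff_add, h, h', coeff_add, mul_add]

/-- The Taylor expansion at `q` of a homogeneous `g`-invariant of degree `k` has only terms of
weight congruent to `k`. -/
theorem taylorAt_mem_weightsIn_modEq {N : ℕ} (hN : N ≠ 0) {ζ : ℂ} (hζ : IsPrimitiveRoot ζ N)
    (hd : ∀ α, 0 < d α) {g : V ≃ₗ[ℂ] V} {q : V} (hq : g q = ζ • q)
    {z : Basis (Fin n) ℂ (Dual ℂ V)}
    (hz : ∀ α, act g (lin (z α)) = ζ ^ (d α - 1) • lin (z α))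
    {F : PolyAlg V} (hF : act g F = F) {k : ℕ} (hk : F ∈ dualPart V ^ k) :
    taylorAt z q F ∈ weightsIn ℂ d {i | i ≡ k [MOD N]} := by
  have hζ0 : ζ ≠ 0 := hζ.ne_zero hN
  have hpow : ∀ {i j : ℕ}, ζ ^ i = ζ ^ j → i ≡ j [MOD N] := fun {i j} h => by
    rwa [(hζ.isOfFinOrder hN).pow_eq_pow_iff_modEq, ← hζ.eq_orderOf] at h
  have hsub : ∀ i : Fin n, ∀ m : ℕ, ζ ^ (d i * m) = ζ ^ m * (ζ ^ (d i - 1)) ^ m := fun i m => by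
    rw [← pow_mul, ← pow_add]
    congr 1
    obtain ⟨e, he⟩ := Nat.exists_eq_add_of_lt (hd i)
    rw [he]
    simp only [zero_add, Nat.add_sub_cancel]
    ring
  -- Evaluating the eigenvector equation of `z i` at q gives ζ⁻¹ z_i(q) = ζ^(d_i - 1) z_i(q).
  have hqz : ∀ i, z i q = 0 ∨ 0 ≡ d i [MOD N] := by
    intro i
    have h1 := congrArg (evalAt q) (hz i)
    rw [evalAt_act, map_smul, evalAt_lin, evalAt_lin, smul_eq_mul] at h1
    have h2 : g.symm q = ζ⁻¹ • q := by
      rw [LinearEquiv.symm_apply_eq, map_smul, hq, smul_smul, inv_mul_cancel₀ hζ0, one_smul]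
    rw [h2, map_smul, smul_eq_mul] at h1
    by_cases h0 : z i q = 0
    · exact Or.inl h0
    · right
      apply hpow
      have h3 := mul_right_cancel₀ h0 h1
      have h4 := hsub i 1
      rw [pow_one, pow_one, mul_one, ← h3, mul_inv_cancel₀ hζ0] at h4
      rw [pow_zero, h4]
  set p := SymmetricAlgebra.equivMvPolynomial z F with hp
  have hact : aeval (fun i => C (ζ ^ (d i - 1)) * X i) p = p := by
    conv_rhs => rw [hp, ← hF]
    have : (aeval fun i => C (ζ ^ (d i - 1)) * X i).comp
        (SymmetricAlgebra.equivMvPolynomial z).toAlgHom =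
        (SymmetricAlgebra.equivMvPolynomial z).toAlgHom.comp (act g) := by
      refine algHom_ext_basis z fun i => ?_
      rw [AlgHom.comp_apply, AlgHom.comp_apply, hz, map_smul]
      simp [smul_eq_C_mul]
    exact DFunLike.congr_fun this F
  -- A monomial z^m of `p` is fixed by g and has |m| = k, so ζ^(d·m) = ζ^|m| · ∏ (ζ^(d_i - 1))^(m_i)
  -- = ζ^k.
  have hpmem : p ∈ weightsIn ℂ d {i | i ≡ k [MOD N]} := by
    intro m hm
    have h1 := coeff_aeval_C_mul_X (fun i => ζ ^ (d i - 1)) p m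
    rw [hact, eq_comm, mul_eq_right₀ hm] at h1
    have h2 := isWeightedHomogeneous_of_mem_dualPart_pow z hk hm
    apply hpow
    rw [← wdeg_eq_weight, wdeg, ← Finset.prod_pow_eq_pow_sum, Finset.prod_congr rfl
      (fun i _ => hsub i (m i)), Finset.prod_mul_distrib, Finset.prod_pow_eq_pow_sum]
    rw [Finsupp.prod_fintype _ _ (fun _ => pow_zero _)] at h1
    rw [h1, mul_one, ← h2, ← size_eq_weight, size]
  -- The translation replaces z_i by z_i + z_i(q), and by `hqz` both terms have weight congruent to
  -- `d i`, or the second vanishes.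
  refine (isAdditive_modEq N).aeval_mem (fun i => ?_) (D := {i | i ≡ k [MOD N]}) ?_ hpmem
  · refine Submodule.add_mem _ (X_mem_weightsIn (Nat.ModEq.refl _)) ?_
    rcases hqz i with h | h
    · simp only [h, map_zero]
      exact Submodule.zero_mem _
    · exact C_mem_weightsIn _ h _
  · exact fun i hi j hj => Nat.ModEq.trans hj hi

/-- The Taylor expansions of the basic invariants at `q` have terms of weights in `d α + N ℕ` only,
apart from the constant term. -/
structure HasProgressionWeights (d : Fin n → ℕ) (N : ℕ) (x : Fin n → invariants G)
    (z : Basis (Fin n) ℂ (Dual ℂ V)) (q : V) : Prop where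
  sub_const_mem : ∀ α, taylorAt z q (x α) - C (evalAt q (x α)) ∈
    weightsIn ℂ d {i | ∃ j, i = d α + N * j}
  evalAt_eq_zero : ∀ α, d α ≠ N → evalAt q (x α) = 0

/-- As 0 < d_α ≤ N, no positive integer below d_α is congruent to d_α mod N. A nonzero constant term
would make N divide d_α, hence d_α = N. -/
theorem IsBasicInvariants.hasProgressionWeights (hx : IsBasicInvariants G d x) {N : ℕ}
    (hdN : ∀ α, d α ≤ N) (hN : N ≠ 0) {ζ : ℂ} (hζ : IsPrimitiveRoot ζ N) {g : V ≃ₗ[ℂ] V}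
    (hg : g ∈ G) {q : V} (hq : g q = ζ • q) {z : Basis (Fin n) ℂ (Dual ℂ V)}
    (hz : ∀ α, act g (lin (z α)) = ζ ^ (d α - 1) • lin (z α)) :
    HasProgressionWeights d N x z q := by
  have key : ∀ α, taylorAt z q (x α) ∈ weightsIn ℂ d {i | i ≡ d α [MOD N]} := fun α =>
    taylorAt_mem_weightsIn_modEq hN hζ hx.degree_pos hq hz ((x α).2 g hg) (hx.homogeneous α)
  constructor
  · intro α m hm
    rw [coeff_sub, coeff_C] at hm
    have hm0 : m ≠ 0 := by
      rintro rfl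
      refine hm ?_
      rw [if_pos rfl, ← constantCoeff_taylorAt z, constantCoeff_eq, sub_self]
    rw [if_neg hm0.symm, sub_zero] at hm
    have h1 : _ ≡ _ [MOD N] := key α m hm
    have h2 : 0 < Finsupp.weight d m := by
      obtain ⟨i, hi⟩ := Finsupp.ne_iff.1 hm0
      exact (hx.degree_pos i).trans_le
        (Finsupp.le_weight_of_ne_zero' d hi)
    have h3 : d α ≤ Finsupp.weight d m := by
      by_contra h
      push Not at h
      have h4 := (Nat.modEq_iff_dvd' h.le).1 h1
      have := Nat.le_of_dvd (Nat.sub_pos_of_lt h) h4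
      have := hdN α
      omega
    obtain ⟨j, hj⟩ := (Nat.modEq_iff_dvd' h3).1 h1.symm
    exact ⟨j, by omega⟩
  · intro α hα
    by_contra h
    rw [← constantCoeff_taylorAt z, constantCoeff_eq] at h
    have h1 : _ ≡ _ [MOD N] := key α 0 h
    rw [map_zero] at h1
    have h2 := (Nat.modEq_zero_iff_dvd).1 h1.symm
    exact hα (le_antisymm (hdN α) (Nat.le_of_dvd (hx.degree_pos α) h2))

theorem HasProgressionWeights.shiftedMonomial_mem {N : ℕ} {z : Basis (Fin n) ℂ (Dual ℂ V)} {q : V}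
    (h : HasProgressionWeights d N x z q) (a : Fin n →₀ ℕ) :
    taylorAt z q (shiftedMonomial x q a) ∈
      weightsIn ℂ d {i | ∃ j, i = Finsupp.weight d a + N * j} := by
  rw [taylorAt_shiftedMonomial]
  exact (isAdditive_progression N).prod_mem h.sub_const_mem a

theorem HasProgressionWeights.mem_Ici {N : ℕ} {z : Basis (Fin n) ℂ (Dual ℂ V)} {q : V}
    (h : HasProgressionWeights d N x z q) (α : Fin n) :
    taylorAt z q (x α) - C (evalAt q (x α)) ∈ weightsIn ℂ d (Set.Ici (d α)) := by
  refine weightsIn_mono ?_ (h.sub_const_mem α)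
  rintro _ ⟨j, rfl⟩
  exact Nat.le_add_right _ _

theorem weightedHomogeneousComponent_sub_C {σ R : Type*} [CommRing R] (w : σ → ℕ) {k : ℕ}
    (hk : k ≠ 0) (p : MvPolynomial σ R) (c : R) :
    weightedHomogeneousComponent w k (p - C c) = weightedHomogeneousComponent w k p := by
  rw [map_sub, (isWeightedHomogeneous_C w c).weightedHomogeneousComponent_ne k hk, sub_zero]

/-- Each factor has only weights at least d_α, so lowest components multiply. This is what makes ψ
multiplicative. -/
theorem HasProgressionWeights.component_shiftedMonomial {N : ℕ} {z : Basis (Fin n) ℂ (Dual ℂ V)}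
    {q : V} (h : HasProgressionWeights d N x z q) (hd : ∀ α, 0 < d α) (a : Fin n →₀ ℕ) :
    weightedHomogeneousComponent d (Finsupp.weight d a) (taylorAt z q (shiftedMonomial x q a)) =
      aeval (leadingPart d x z q) (MvPolynomial.monomial a (1 : ℂ)) := by
  rw [taylorAt_shiftedMonomial, weightedHomogeneousComponent_prod h.mem_Ici, aeval_monomial,
    map_one, one_mul]
  simp only [weightedHomogeneousComponent_sub_C d (hd _).ne', leadingPart]

/-- The linear part of the leading part of a basic invariant is given by the Jacobian matrix. -/
theorem HasProgressionWeights.coeff_single_leadingPart {N : ℕ} {z : Basis (Fin n) ℂ (Dual ℂ V)}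
    {q : V} (h : HasProgressionWeights d N x z q) (hd : ∀ α, 0 < d α) (hdN : ∀ α, d α ≤ N)
    (α β : Fin n) :
    coeff (Finsupp.single β 1) (leadingPart d x z q α) = jacobian x z q α β := by
  rw [leadingPart, coeff_weightedHomogeneousComponent, Finsupp.weight_single, one_smul, jacobian,
    Matrix.of_apply, evalAt_partialDeriv]
  split_ifs with hαβ
  · rfl
  -- If d_β ≠ d_α, a nonzero entry would require d_β = d_α + N j with j > 0, which exceeds N.
  · by_contra hne
    have h1 := h.sub_const_mem α (Finsupp.single β 1) (by
      rw [coeff_sub, coeff_C, if_neg (Finsupp.single_ne_zero.2 one_ne_zero).symm, sub_zero]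
      exact Ne.symm hne)
    rw [Finsupp.weight_single, one_smul] at h1
    obtain ⟨j, hj⟩ := h1
    rcases Nat.eq_zero_or_pos j with rfl | hj0
    · exact hαβ (by simpa using hj)
    · have h2 := Nat.le_mul_of_pos_right N hj0
      have := hdN β
      have := hd α
      omega

theorem finsum_component (z : Basis (Fin n) ℂ (Dual ℂ V)) (k : ℕ) (p : MvPolynomial (Fin n) ℂ) :
    (∑ᶠ (b : Fin n →₀ ℕ) (_ : wdeg d b = k), coeff b p • monomial z b) =
      (SymmetricAlgebra.equivMvPolynomial z).symm (weightedHomogeneousComponent d k p) := by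
  classical
  have h1 : ∀ b, (∑ᶠ (_ : wdeg d b = k), coeff b p • monomial z b) =
      coeff b (weightedHomogeneousComponent d k p) • monomial z b := by
    intro b
    rw [coeff_weightedHomogeneousComponent, ← wdeg_eq_weight, finsum_eq_if]
    split_ifs
    · rfl
    · rw [zero_smul]
  simp only [h1]
  set r := weightedHomogeneousComponent d k p
  rw [AlgEquiv.eq_symm_apply, finsum_eq_sum_of_support_subset (s := r.support)]
  · conv_rhs => rw [MvPolynomial.as_sum r]
    rw [map_sum]
    refine Finset.sum_congr rfl fun b _ => ?_
    rw [map_smul, equivMvPolynomial_monomial, smul_monomial, smul_eq_mul, mul_one]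
  · intro b hb
    rw [Function.mem_support] at hb
    exact MvPolynomial.mem_support_iff.2 fun h => hb (by rw [h, zero_smul])

/-- `ψ` is the algebra map which sends each of the basic invariants to its leading part. -/
theorem psi_aeval (hx : IsBasicInvariants G d x) {N : ℕ} {z : Basis (Fin n) ℂ (Dual ℂ V)} {q : V}
    (h : HasProgressionWeights d N x z q) (p : MvPolynomial (Fin n) ℂ) :
    psi hx z q (aeval x p) =
      (SymmetricAlgebra.equivMvPolynomial z).symm (aeval (leadingPart d x z q) p) := by
  have key : psi hx z q ∘ₗ (aeval x).toLinearMap =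
      (SymmetricAlgebra.equivMvPolynomial z).symm.toLinearMap ∘ₗ
        (aeval (leadingPart d x z q)).toLinearMap := by
    refine (basisMonomials (Fin n) ℂ).ext fun a => ?_
    rw [coe_basisMonomials]
    have h1 : aeval x (MvPolynomial.monomial a (1 : ℂ)) = monomialBasis hx a := by
      rw [monomialBasis_apply, aeval_monomial, map_one, one_mul,
        Finsupp.prod_fintype _ _ (fun i => pow_zero _)]
    change psi hx z q (aeval x (MvPolynomial.monomial a (1 : ℂ))) =
      (SymmetricAlgebra.equivMvPolynomial z).symm (aeval _ (MvPolynomial.monomial a (1 : ℂ)))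
    rw [h1, psi, Basis.constr_basis, ← h.component_shiftedMonomial hx.degree_pos,
      ← wdeg_eq_weight, ← finsum_component]
    simp only [one_div_multiFactorial_mul_evalAt]
  exact DFunLike.congr_fun key p

theorem bijective_psi (hx : IsBasicInvariants G d x) {N : ℕ} {z : Basis (Fin n) ℂ (Dual ℂ V)}
    {q : V} (h : HasProgressionWeights d N x z q) (hdN : ∀ α, d α ≤ N)
    (hJ : IsUnit (jacobian x z q)) : Function.Bijective (psi hx z q) := by
  have h1 := bijective_aeval_of_isUnit_linearPart hx.degree_pos
    (f := leadingPart d x z q) (isWeightedHomogeneous_leadingPart z q) (by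
      convert hJ using 1
      ext α β
      exact h.coeff_single_leadingPart hx.degree_pos hdN α β)
  have h2 : Function.Bijective (aeval x : MvPolynomial (Fin n) ℂ →ₐ[ℂ] invariants G) :=
    ⟨hx.algebraicIndependent, hx.exists_aeval_eq⟩
  have h3 : psi hx z q ∘ aeval x = (SymmetricAlgebra.equivMvPolynomial z).symm ∘
      aeval (leadingPart d x z q) := funext (psi_aeval hx h)
  rw [← Function.Bijective.of_comp_iff _ h2, h3]
  exact (SymmetricAlgebra.equivMvPolynomial z).symm.bijective.comp h1

/-- On homogeneous invariants of degree at most `N`, the map `ψ` takes the leading part. -/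
theorem psi_eq_component (hx : IsBasicInvariants G d x) {N : ℕ} {z : Basis (Fin n) ℂ (Dual ℂ V)}
    {q : V} (h : HasProgressionWeights d N x z q) {k : ℕ} (hk : k ≠ 0) (hkN : k ≤ N)
    {p : MvPolynomial (Fin n) ℂ} (hp : IsWeightedHomogeneous d p k) :
    psi hx z q (aeval x p) = (SymmetricAlgebra.equivMvPolynomial z).symm
      (weightedHomogeneousComponent d k (taylorAt z q (aeval x p : invariants G))) := by
  rw [psi_aeval hx h, map_coe_aeval]
  congr 1
  rw [MvPolynomial.as_sum p, map_sum, map_sum, map_sum]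
  refine Finset.sum_congr rfl fun m hm => ?_
  have hmk : Finsupp.weight d m = k := hp (MvPolynomial.mem_support_iff.1 hm)
  have hd := hx.degree_pos
  rw [← mul_one (coeff m p), ← smul_eq_mul, ← smul_monomial, map_smul, map_smul, map_smul]
  congr 1
  -- Since the weight of `m` is at most N, either `m` is a single variable, or it involves no
  -- variable of weight N. In the latter case all its factors vanish at q, and the shifted monomial
  -- is the monomial itself.
  by_cases hlin : ∃ β, m = Finsupp.single β 1
  · obtain ⟨β, rfl⟩ := hlin
    rw [Finsupp.weight_single, one_smul] at hmk
    subst hmk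
    change aeval _ (X β) = weightedHomogeneousComponent d (d β) (aeval _ (X β))
    rw [aeval_X, aeval_X]
    rfl
  · have h0 : ∀ β ∈ m.support, evalAt q (x β) = 0 := by
      intro β hβ
      apply h.evalAt_eq_zero
      intro hβN
      refine hlin ⟨β, ?_⟩
      have hβ1 : 1 ≤ m β := Nat.one_le_iff_ne_zero.2 (Finsupp.mem_support_iff.1 hβ)
      obtain ⟨m', rfl⟩ : ∃ m', m = Finsupp.single β 1 + m' :=
        ⟨m - Finsupp.single β 1, (add_tsub_cancel_of_le (Finsupp.single_le_iff.2 hβ1)).symm⟩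
      rw [map_add, Finsupp.weight_single, one_smul] at hmk
      have h1 : Finsupp.weight d m' = 0 := by omega
      have h2 : m' = 0 := by
        ext l
        by_contra hl
        have h3 := Finsupp.le_weight_of_ne_zero' d hl
        have := hd l
        omega
      rw [h2, add_zero]
    rw [← h.component_shiftedMonomial hd m, ← hmk, taylorAt_shiftedMonomial, aeval_monomial,
      map_one, one_mul]
    congr 1
    refine Finset.prod_congr rfl fun β hβ => ?_
    dsimp only
    rw [h0 β hβ, map_zero, sub_zero]

/-- The value of `ψ` on any set of basic invariants. -/
theorem psi_basicInvariant {y : Fin n → invariants G} (hy : IsBasicInvariants G d y) {N : ℕ}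
    {z : Basis (Fin n) ℂ (Dual ℂ V)} {q : V} (h : HasProgressionWeights d N y z q)
    (hdN : ∀ α, d α ≤ N) (hx : ∀ α, (x α : PolyAlg V) ∈ dualPart V ^ d α) (α : Fin n) :
    psi hy z q (x α) =
      (SymmetricAlgebra.equivMvPolynomial z).symm (leadingPart d x z q α) := by
  obtain ⟨p, hp, hpx⟩ := hy.exists_isWeightedHomogeneous z (hx α)
  rw [leadingPart, ← hpx]
  exact psi_eq_component hy h (hy.degree_pos α).ne' (hdN α) hp

/-- An inverse image of `z α` under `ψ` is homogeneous of degree `d α`. -/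
theorem mem_dualPart_pow_of_psi_eq {y : Fin n → invariants G} (hy : IsBasicInvariants G d y)
    {N : ℕ} {z : Basis (Fin n) ℂ (Dual ℂ V)} {q : V} (h : HasProgressionWeights d N y z q)
    (hinj : Function.Injective (psi hy z q)) {α : Fin n} {F : invariants G}
    (hF : psi hy z q F = lin (z α)) : (F : PolyAlg V) ∈ dualPart V ^ d α := by
  obtain ⟨p, rfl⟩ := hy.exists_aeval_eq F
  -- The map ψ respects weights and z^α has weight d_α, so only the component of `p` of weight d_α
  -- matters; injectivity then identifies the two preimages.
  have h1 : psi hy z q (aeval y (weightedHomogeneousComponent d (d α) p)) =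
      psi hy z q (aeval y p) := by
    rw [hF, psi_aeval hy h, ← weightedHomogeneousComponent_aeval
      (isWeightedHomogeneous_leadingPart z q)]
    rw [psi_aeval hy h, AlgEquiv.symm_apply_eq] at hF
    rw [hF, SymmetricAlgebra.equivMvPolynomial_ι_apply,
      (isWeightedHomogeneous_X ℂ d α).weightedHomogeneousComponent_same,
      SymmetricAlgebra.equivMvPolynomial_symm_X]
  rw [← hinj h1]
  exact coe_aeval_mem_dualPart_pow hy.homogeneous
    (weightedHomogeneousComponent_isWeightedHomogeneous _ _)

/-- By bijectivity ψ⁻¹(V*) has dimension n, so n independent elements of it already form a basis. -/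
theorem isGood_iff {y : Fin n → invariants G} (hy : IsBasicInvariants G d y)
    {z : Basis (Fin n) ℂ (Dual ℂ V)} {q : V} (hbij : Function.Bijective (psi hy z q))
    (hx : LinearIndependent ℂ x) :
    IsGood (psi hy z q) x ↔ ∀ α, psi hy z q (x α) ∈ dualPart V := by
  constructor
  · intro h α
    have : x α ∈ (dualPart V).comap (psi hy z q) := by
      rw [← h.2]
      exact Submodule.subset_span ⟨α, rfl⟩
    exact this
  · intro h
    refine ⟨hx, ?_⟩
    let e := LinearEquiv.ofBijective (psi hy z q) hbij
    let D : (dualPart V).comap (psi hy z q) ≃ₗ[ℂ] Dual ℂ V :=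
      (e.ofSubmodule' (dualPart V)).trans
        (LinearEquiv.ofInjective (lin (V := V)) lin_injective).symm
    have hfin : Module.Finite ℂ ((dualPart V).comap (psi hy z q)) :=
      Module.Finite.of_basis (z.map D.symm)
    apply Submodule.eq_of_le_of_finrank_eq
    · rw [Submodule.span_le]
      rintro _ ⟨α, rfl⟩
      exact h α
    · rw [finrank_span_eq_card hx, D.finrank_eq, finrank_eq_card_basis z]

theorem IsBasicInvariants.linearIndependent (hx : IsBasicInvariants G d x) :
    LinearIndependent ℂ x := hx.algebraicIndependent.linearIndependent

theorem equivMvPolynomial_symm_mem_dualPart_iff (z : Basis (Fin n) ℂ (Dual ℂ V))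
    (p : MvPolynomial (Fin n) ℂ) :
    (SymmetricAlgebra.equivMvPolynomial z).symm p ∈ dualPart V ↔
      IsWeightedHomogeneous (fun _ => 1) p 1 := by
  rw [mem_dualPart_iff z, AlgEquiv.apply_symm_apply]

/-- A linear form is determined by its coefficients. -/
theorem eq_X_of_isWeightedHomogeneous_one {σ R : Type*} [CommRing R] {p : MvPolynomial σ R}
    (hp : IsWeightedHomogeneous (fun _ => 1) p 1) {α : σ} [DecidableEq σ]
    (h : ∀ β, coeff (Finsupp.single β 1) p = if α = β then 1 else 0) : p = X α := by
  ext m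
  rw [coeff_X]
  by_cases hm : m ∈ Set.range fun i : σ => Finsupp.single i 1
  · obtain ⟨β, rfl⟩ := hm
    dsimp only
    rw [h]
    simp [Finsupp.single_left_inj]
  · rw [if_neg fun h => hm ⟨α, h⟩]
    refine hp.coeff_eq_zero m fun h => hm ?_
    rw [Finsupp.range_single_one, Set.mem_ofPred_eq, Finsupp.degree_eq_weight_one]
    exact h

/-- The inverse images of the coordinates under `ψ` are basic invariants. -/
theorem isBasicInvariants_of_psi_eq {y : Fin n → invariants G} (hy : IsBasicInvariants G d y)
    {N : ℕ} {z : Basis (Fin n) ℂ (Dual ℂ V)} {q : V} (h : HasProgressionWeights d N y z q)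
    (hbij : Function.Bijective (psi hy z q)) (hx : ∀ α, psi hy z q (x α) = lin (z α)) :
    IsBasicInvariants G d x := by
  have hmul : ∀ F F', psi hy z q (F * F') = psi hy z q F * psi hy z q F' := by
    intro F F'
    obtain ⟨p, rfl⟩ := hy.exists_aeval_eq F
    obtain ⟨p', rfl⟩ := hy.exists_aeval_eq F'
    rw [← map_mul, psi_aeval hy h, psi_aeval hy h, psi_aeval hy h, map_mul, map_mul]
  have hone : psi hy z q 1 = 1 := by
    rw [← map_one (aeval y : MvPolynomial (Fin n) ℂ →ₐ[ℂ] invariants G), psi_aeval hy h, map_one,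
      map_one]
  let Ψ : invariants G →ₐ[ℂ] PolyAlg V := AlgHom.ofLinearMap (psi hy z q) hone hmul
  -- Followed by the bijection ψ, the substitution of `x` is the coordinate isomorphism. Hence it is
  -- bijective: `x` is independent and generates.
  have hΨ : Ψ.comp (aeval x) =
      ((SymmetricAlgebra.equivMvPolynomial z).symm : MvPolynomial (Fin n) ℂ →ₐ[ℂ] PolyAlg V) := by
    refine MvPolynomial.algHom_ext fun i => ?_
    rw [AlgHom.comp_apply, aeval_X]
    exact (hx i).trans (SymmetricAlgebra.equivMvPolynomial_symm_X z i).symm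
  have haeval : Function.Bijective (aeval x : MvPolynomial (Fin n) ℂ →ₐ[ℂ] invariants G) := by
    rw [← Function.Bijective.of_comp_iff' (f := Ψ) hbij, ← AlgHom.coe_comp, hΨ]
    exact (SymmetricAlgebra.equivMvPolynomial z).symm.bijective
  refine ⟨hy.monotone, fun α => mem_dualPart_pow_of_psi_eq hy h hbij.1 (hx α), haeval.1, ?_⟩
  rw [Algebra.adjoin_range_eq_range_aeval, AlgHom.range_eq_top]
  exact haeval.2

end Psi

end GoodInvariants

/-! ### The five assertions, read off from leading parts -/

theorem proposition5p2 {V : Type*} [AddCommGroup V] [Module ℂ V] [FiniteDimensional ℂ V]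
    {n : ℕ} [NeZero n] (G : Subgroup (V ≃ₗ[ℂ] V)) [Finite G] (hG : IsReflectionGroup G)
    (d : Fin n → ℕ) (g : V ≃ₗ[ℂ] V) (ζ : ℂ) (q : V) (hadm : IsAdmissible G d g ζ q)
    (z : Module.Basis (Fin n) ℂ (Module.Dual ℂ V))
    (hz : ∀ α, act g (lin (z α)) = ζ ^ (d α - 1) • lin (z α))
    (y : Fin n → invariants G) (hy : IsBasicInvariants G d y) :
    -- (i)
    (Function.Bijective (psi hy z q) ∧
      ∀ x : Fin n → invariants G, (∀ α, psi hy z q (x α) = lin (z α)) →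
        IsBasicInvariants G d x ∧ IsGood (psi hy z q) x ∧ IsCompatible x z q) ∧
    -- (ii)
    (∀ x : Fin n → invariants G, IsBasicInvariants G d x → IsGood (psi hy z q) x →
      IsCompatible x z q → ∀ α, psi hy z q (x α) = lin (z α)) ∧
    -- (iii)
    (∀ x : Fin n → invariants G, IsBasicInvariants G d x → ∀ a b : Fin n →₀ ℕ,
      (¬ ∃ j : ℕ, wdeg d b = wdeg d a + d ⊤ * j) →
        evalAt q (iterDeriv z b (shiftedMonomial x q a)) = 0) ∧
    -- (iv)
    (∀ x : Fin n → invariants G, IsBasicInvariants G d x →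
      (IsGood (psi hy z q) x ↔
        ∀ (α : Fin n) (a : Fin n →₀ ℕ), d α = wdeg d a → 2 ≤ size a →
          evalAt q (iterDeriv z a (x α)) = 0)) ∧
    -- (v)
    (∀ x : Fin n → invariants G, IsBasicInvariants G d x → IsGood (psi hy z q) x →
      IsCompatible x z q → ∀ a b : Fin n →₀ ℕ, wdeg d a = wdeg d b →
        (1 / (multiFactorial b : ℂ)) * evalAt q (iterDeriv z b (shiftedMonomial x q a)) =
          if a = b then 1 else 0) := by
  have hd := hy.degree_pos
  have hN : d ⊤ ≠ 0 := (hd ⊤).ne'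
  have hdN : ∀ α, d α ≤ d ⊤ := fun α => hy.monotone le_top
  have hprog : ∀ x : Fin n → invariants G, IsBasicInvariants G d x →
      HasProgressionWeights d (d ⊤) x z q := fun x hx =>
    hx.hasProgressionWeights hdN hN hadm.primitive hadm.mem hadm.eigenvector hz
  have hy' := hprog y hy
  obtain ⟨x₀, z₀, -, hJ₀⟩ := hadm.regular
  have hbij : Function.Bijective (psi hy z q) :=
    bijective_psi hy hy' hdN (hy.isUnit_jacobian hJ₀ z)
  have hlead : ∀ x : Fin n → invariants G, IsBasicInvariants G d x → ∀ α,
      psi hy z q (x α) = (SymmetricAlgebra.equivMvPolynomial z).symm (leadingPart d x z q α) :=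
    fun x hx => psi_basicInvariant hy hy' hdN hx.homogeneous
  -- Goodness makes the leading parts linear forms; compatibility fixes their coefficients.
  have hii : ∀ x : Fin n → invariants G, IsBasicInvariants G d x → IsGood (psi hy z q) x →
      IsCompatible x z q → ∀ α, leadingPart d x z q α = MvPolynomial.X α := by
    intro x hx hgood hcomp α
    have h1 := (isGood_iff hy hbij hx.linearIndependent).1 hgood α
    rw [hlead x hx, equivMvPolynomial_symm_mem_dualPart_iff] at h1
    refine eq_X_of_isWeightedHomogeneous_one h1 fun β => ?_
    rw [(hprog x hx).coeff_single_leadingPart hd hdN, hcomp, Matrix.one_apply]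
  refine ⟨⟨hbij, ?_⟩, ?_, ?_, ?_, ?_⟩
  · intro x hpsi
    have hx : IsBasicInvariants G d x := isBasicInvariants_of_psi_eq hy hy' hbij hpsi
    have hX : ∀ α, leadingPart d x z q α = MvPolynomial.X α := fun α => by
      have h1 := hlead x hx α
      rwa [hpsi, AlgEquiv.eq_symm_apply, SymmetricAlgebra.equivMvPolynomial_ι_apply,
        eq_comm] at h1
    refine ⟨hx, (isGood_iff hy hbij hx.linearIndependent).2 fun α => ?_, ?_⟩
    · rw [hpsi]
      exact ⟨z α, rfl⟩
    · ext α β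
      rw [← (hprog x hx).coeff_single_leadingPart hd hdN, hX, MvPolynomial.coeff_X,
        Matrix.one_apply]
      simp [Finsupp.single_left_inj]
  · intro x hx hgood hcomp α
    rw [hlead x hx, hii x hx hgood hcomp, SymmetricAlgebra.equivMvPolynomial_symm_X]
  · intro x hx a b hab
    rw [evalAt_iterDeriv]
    by_contra hne
    obtain ⟨j, hj⟩ := (hprog x hx).shiftedMonomial_mem a b (right_ne_zero_of_mul hne)
    exact hab ⟨j, by rw [wdeg_eq_weight, wdeg_eq_weight, hj]⟩
  · intro x hx
    rw [isGood_iff hy hbij hx.linearIndependent]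
    refine forall_congr' fun α => ?_
    rw [hlead x hx, equivMvPolynomial_symm_mem_dualPart_iff]
    constructor
    · intro h a hda ha
      have h1 := h.coeff_eq_zero a (by rw [← size_eq_weight]; omega)
      rw [leadingPart, MvPolynomial.coeff_weightedHomogeneousComponent, ← wdeg_eq_weight,
        if_pos hda.symm] at h1
      rw [evalAt_iterDeriv, h1, mul_zero]
    · intro h m hm
      rw [← size_eq_weight]
      have hw := isWeightedHomogeneous_leadingPart z q α hm
      -- The weight d_α is positive, so the leading part has no constant term; once sizes at least 2
      -- are excluded, only linear terms remain.
      have h0 : size m ≠ 0 := by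
        intro h0
        have hm0 : m = 0 := by
          ext i
          exact Finset.sum_eq_zero_iff.1 h0 i (Finset.mem_univ i)
        rw [hm0, map_zero] at hw
        exact (hd α).ne hw
      by_contra h1
      have h2 := h m (by rw [wdeg_eq_weight, hw]) (by omega)
      rw [evalAt_iterDeriv] at h2
      rw [leadingPart, MvPolynomial.coeff_weightedHomogeneousComponent, if_pos hw] at hm
      exact mul_ne_zero (multiFactorial_ne_zero m) hm h2
  · intro x hx hgood hcomp a b hab
    -- With the coordinates as leading parts, the component of weight d·a of the shifted monomial is
    -- the monomial with exponent `a`.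
    have h1 := congrArg (MvPolynomial.coeff b) ((hprog x hx).component_shiftedMonomial hd a)
    rw [MvPolynomial.coeff_weightedHomogeneousComponent, ← wdeg_eq_weight, ← wdeg_eq_weight,
      if_pos hab.symm, funext (hii x hx hgood hcomp), MvPolynomial.aeval_X_left_apply,
      MvPolynomial.coeff_monomial] at h1
    rw [one_div_multiFactorial_mul_evalAt, h1]
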